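/- An \emph{online Turing machine} is a deterministic Turing machine with finitely many states, a read-only input tape whose head can stay or move to the right but never to the left, and a read-write working tape over a finite alphabet, infinite in both directions and initially blank. The input is followed by an end mark, which the input head does not leave. A machine \emph{with shifted input} receives a word $w$ of length $n$ over a finite alphabet $\Sigma$ (which does not contain the empty symbol or the end mark) as the tape content that consists of $n$ empty squares followed by $w$; it starts on the first of these $2n$ squares. It \emph{recognizes} $L\subseteq\Sigma^*$ if, for every $w\in\Sigma^*$, it halts in an accepting state on $w$ exactly when $w\in L$. It \emph{uses at most $f(n)$ memory} if, for every $n$ and every input word of length $n$, its working head visits at most $f(n)$ squares of the working tape. Let $\mathrm{1DSPACE}'(f)$ be the class of languages recognized by online Turing machines with shifted input that use at most $f(n)$ memory, and let $\mathrm{1DSPACE}'(o(\log))$ be the union of the classes $\mathrm{1DSPACE}'(f)$ over all $f:\mathbb{N}\to\mathbb{R}$ with $f(n)=o(\log n)$ as $n\to\infty$. \textbf{Lemma.} Over every finite alphabet, $\mathrm{1DSPACE}'(o(\log)) = \mathrm{REG}$, the class of regular languages. -/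

import Mathlib

/-- The possible contents of a scanned square of the input tape: an empty square, a letter of the
input alphabet, or the mark behind the last square of the input. -/
inductive InputSymbol (α : Type*) where
  | empty : InputSymbol α
  | letter (a : α) : InputSymbol α
  | endMark : InputSymbol α

/-- A deterministic online Turing machine over the input alphabet `α`: it has a read-only input
tape whose head never moves to the left, and one read-write working tape, infinite in both
directions.

`step q x g` describes the step taken in state `q` when the input head scans `x` and the working
head scans `g`; it is `none` when the machine halts. Otherwise it gives the new state, the symbol
written on the working tape, the shift (`-1`, `0` or `1`) of the working head, and whether the
input head advances by one square (`true`) or stays (`false`). -/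
structure OnlineTM (α : Type*) where
  State : Type
  [finiteState : Finite State]
  WorkSymbol : Type
  [finiteWorkSymbol : Finite WorkSymbol]
  blank : WorkSymbol
  start : State
  accepting : Set State
  step : State → InputSymbol α → WorkSymbol → Option (State × WorkSymbol × SignType × Bool)

namespace OnlineTM

variable {α : Type*}

/-- A configuration of an online Turing machine. As the input head only moves to the right, the
input tape is represented by the part `rest` that starts at the scanned square. The entry `none`
is an empty square. When `rest` is exhausted, the head scans the end mark. -/
structure Config (M : OnlineTM α) where
  state : M.State
  work : ℤ → M.WorkSymbol
  head : ℤ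
  rest : List (Option α)

/-- The symbol scanned by the input head. -/
def scanned : List (Option α) → InputSymbol α
  | [] => InputSymbol.endMark
  | none :: _ => InputSymbol.empty
  | some a :: _ => InputSymbol.letter a

/-- One step of the computation; `none` if the machine halts. -/
def next (M : OnlineTM α) (c : M.Config) : Option M.Config :=
  (M.step c.state (scanned c.rest) (c.work c.head)).map fun r =>
    { state := r.1
      work := Function.update c.work c.head r.2.1
      head := c.head + (r.2.2.1 : ℤ)
      rest := if r.2.2.2 then c.rest.tail else c.rest }

/-- The initial configuration on a given content of the input tape. -/
def init (M : OnlineTM α) (tape : List (Option α)) : M.Config where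
  state := M.start
  work := fun _ => M.blank
  head := 0
  rest := tape

/-- The machine accepts if it halts in an accepting state. -/
def Accepts (M : OnlineTM α) (tape : List (Option α)) : Prop :=
  ∃ c : M.Config, StateTransition.Reaches M.next (M.init tape) c ∧
    M.next c = none ∧ c.state ∈ M.accepting

/-- The squares of the working tape that the working head visits during the computation. -/
def visited (M : OnlineTM α) (tape : List (Option α)) : Set ℤ :=
  {z | ∃ c : M.Config, StateTransition.Reaches M.next (M.init tape) c ∧ c.head = z}

/-- The computation on the given input tape visits at most `s` squares of the working tape. -/
def UsesAtMost (M : OnlineTM α) (tape : List (Option α)) (s : ℝ) : Prop :=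
  (M.visited tape).Finite ∧ ((M.visited tape).ncard : ℝ) ≤ s

end OnlineTM

/-- The input tape for a machine with shifted input: the word `w` is preceded by as many empty
squares as it has letters. -/
def shiftedInput {α : Type*} (w : List α) : List (Option α) :=
  List.replicate w.length none ++ w.map some

/-- The class `1DSPACE'(f)`: languages recognized by an online Turing machine with shifted input
that uses at most `f n` squares of memory on every input word of length `n`. -/
def OneDSpaceShifted (α : Type*) (f : ℕ → ℝ) : Set (Language α) :=
  {L | ∃ M : OnlineTM α, ∀ w : List α,
    (w ∈ L ↔ M.Accepts (shiftedInput w)) ∧ M.UsesAtMost (shiftedInput w) (f w.length)}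

/-- The class `1DSPACE'(o(g))`: the union of the classes `1DSPACE'(f)` over all `f = o(g)`. -/
def OneDSpaceShiftedLittleO (α : Type*) (g : ℕ → ℝ) : Set (Language α) :=
  {L | ∃ f : ℕ → ℝ, Asymptotics.IsLittleO Filter.atTop f g ∧ L ∈ OneDSpaceShifted α f}

/-!
When an online machine has read a prefix `t` of its input tape, the left quotient by `t` of the
language `T` of accepted tapes is determined by the state, the head position and the content of the
working tape, unless the machine never gets that far and the quotient is trivial. On inputs of large
length `n`, memory `o(log n)` therefore leaves at most `n / 2` quotients. By the pigeonhole
principle, each of them then already occurs on an input of smaller length: loops can be deleted from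
the read part of the word, and also from the empty squares in front of it. Hence only finitely many
quotients occur at all.

Let `T₀` be the quotient of `T` by `|u|` empty squares. The word `u v` is accepted if and only if
the quotient of `T₀` by `|v|` further empty squares, followed by `u`, contains `v`. So the left
quotient by `u` of the recognized language is determined by `T₀` and by the action of `u` on the
quotients of `T` by empty squares. This leaves finitely many cases, and the Myhill-Nerode theorem
applies.
-/

open Filter Asymptotics

section Growth

variable {ι : Type*} {l : Filter ι}

theorem isLittleO_exp_of_isLittleO_log {f x : ι → ℝ}
    (hf : f =o[l] fun i => Real.log (x i)) (hx : Tendsto x l atTop) :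
    (fun i => Real.exp (f i)) =o[l] x := by
  have hlog : Tendsto (fun i => Real.log (x i)) l atTop := Real.tendsto_log_atTop.comp hx
  have hexp : (fun i => Real.exp (f i)) =o[l] fun i => Real.exp (Real.log (x i)) :=
    Real.isLittleO_exp_comp_exp_comp.2 <|
      (IsEquivalent.refl.sub_isLittleO hf).symm.tendsto_atTop hlog
  refine hexp.congr' .rfl ?_
  filter_upwards [hx.eventually_gt_atTop 0] with i hi using Real.exp_log hi

theorem isBigO_natFloor (f : ι → ℝ) : (fun i => (⌊f i⌋₊ : ℝ)) =O[l] f := by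
  refine isBigO_of_le l fun i => ?_
  calc ‖(⌊f i⌋₊ : ℝ)‖ = ⌊f i⌋₊ := by simp
    _ ≤ ⌊|f i|⌋₊ := by exact_mod_cast Nat.floor_mono (le_abs_self (f i))
    _ ≤ ‖f i‖ := Nat.floor_le (abs_nonneg _)

theorem eventually_mul_pow_natFloor_le {f : ℕ → ℝ} (hf : f =o[atTop] fun n : ℕ => Real.log n)
    (C : ℕ) {B : ℕ} (hB : 0 < B) : ∀ᶠ n in atTop, C * B ^ ⌊f n⌋₊ ≤ n := by
  have hlog : (fun n => Real.log B * ⌊f n⌋₊) =o[atTop] fun n : ℕ => Real.log n :=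
    ((isBigO_natFloor f).trans_isLittleO hf).const_mul_left _
  have hexp := (isLittleO_exp_of_isLittleO_log hlog tendsto_natCast_atTop_atTop).const_mul_left C
  filter_upwards [hexp.bound one_pos] with n hn
  have hpow : Real.exp (Real.log B * ⌊f n⌋₊) = (B : ℝ) ^ ⌊f n⌋₊ := by
    rw [← Real.rpow_def_of_pos (by exact_mod_cast hB), Real.rpow_natCast]
  rw [hpow, one_mul, Real.norm_natCast, Real.norm_of_nonneg (by positivity)] at hn
  exact_mod_cast hn

end Growth

section PrefixQuotients

variable {β : Type*} (T : Language β)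

/-- The left quotients of the language `T` by the prefixes of the word `u`. They are the states
through which the minimal automaton of `T` runs when it reads `u`. -/
def prefixQuotients (u : List β) : Set (Language β) :=
  T.leftQuotient '' {v | v <+: u}

variable {T}

theorem leftQuotient_take_mem_prefixQuotients (u : List β) (i : ℕ) :
    T.leftQuotient (u.take i) ∈ prefixQuotients T u :=
  ⟨_, u.take_prefix i, rfl⟩

theorem prefixQuotients_mono {u v : List β} (h : u <+: v) :
    prefixQuotients T u ⊆ prefixQuotients T v :=
  Set.image_mono fun _ ht => List.IsPrefix.trans ht h

theorem finite_prefixQuotients (u : List β) : (prefixQuotients T u).Finite := by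
  have hinits : {v | v <+: u} = {v | v ∈ u.inits} := by simp only [List.mem_inits]
  rw [prefixQuotients, hinits]
  exact u.inits.finite_toSet.image _

theorem prefixQuotients_append (u v : List β) :
    prefixQuotients T (u ++ v) = prefixQuotients T u ∪ prefixQuotients (T.leftQuotient u) v := by
  ext q
  simp only [prefixQuotients, Set.mem_union, Set.mem_image, Set.mem_ofPred_eq]
  constructor
  · rintro ⟨t, ht, rfl⟩
    rcases List.prefix_or_prefix_of_prefix ht (List.prefix_append u v) with htu | ⟨s, rfl⟩
    · exact .inl ⟨t, htu, rfl⟩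
    · exact .inr ⟨s, (List.prefix_append_right_inj u).1 ht, (T.leftQuotient_append u s).symm⟩
  · rintro (⟨t, ht, rfl⟩ | ⟨s, hs, rfl⟩)
    · exact ⟨t, List.prefix_append_of_prefix ht, rfl⟩
    · exact ⟨u ++ s, (List.prefix_append_right_inj u).2 hs, T.leftQuotient_append u s⟩

theorem exists_leftQuotient_take_eq (u : List β) :
    ∃ i j, i < j ∧ j ≤ (prefixQuotients T u).ncard ∧
      T.leftQuotient (u.take i) = T.leftQuotient (u.take j) := by
  set c := (prefixQuotients T u).ncard
  have hcard : c < (Set.Iic c).ncard := by simp [Set.ncard_eq_toFinset_card']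
  obtain ⟨i, hi, j, hj, hij, h⟩ := Set.exists_ne_map_eq_of_ncard_lt_of_maps_to hcard
    (fun i _ => leftQuotient_take_mem_prefixQuotients u i) (finite_prefixQuotients u)
  rcases hij.lt_or_gt with hij | hji
  · exact ⟨i, j, hij, hj, h⟩
  · exact ⟨j, i, hji, hi, h.symm⟩

theorem prefixQuotients_take_append_drop_subset {u : List β} {i j : ℕ} (hij : i ≤ j)
    (h : T.leftQuotient (u.take i) = T.leftQuotient (u.take j)) :
    prefixQuotients T (u.take i ++ u.drop j) ⊆ prefixQuotients T u := by
  conv_rhs => rw [← u.take_append_drop j]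
  rw [prefixQuotients_append, prefixQuotients_append, h]
  exact Set.union_subset_union_left _ (prefixQuotients_mono (List.take_prefix_take_left hij))

theorem exists_sublist_length_lt_leftQuotient_eq (u : List β) :
    ∃ v, v.Sublist u ∧ v.length < (prefixQuotients T u).ncard ∧
      T.leftQuotient v = T.leftQuotient u := by
  induction hn : u.length using Nat.strong_induction_on generalizing u with
  | _ n ih =>
    subst hn
    by_cases hu : u.length < (prefixQuotients T u).ncard
    · exact ⟨u, .refl u, hu, rfl⟩
    obtain ⟨i, j, hij, hj, h⟩ := exists_leftQuotient_take_eq (T := T) u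
    obtain ⟨v, hvu, hv, hq⟩ := ih _ (by grind) (u.take i ++ u.drop j) rfl
    refine ⟨v, hvu.trans ?_, hv.trans_le ?_, hq.trans ?_⟩
    · conv_rhs => rw [← u.take_append_drop j]
      exact (List.take_prefix_take_left hij.le).sublist.append (.refl _)
    · exact Set.ncard_le_ncard (prefixQuotients_take_append_drop_subset hij.le h)
        (finite_prefixQuotients u)
    · rw [T.leftQuotient_append, h, ← T.leftQuotient_append, List.take_append_drop]

theorem exists_lt_leftQuotient_replicate_eq {a : β} {n : ℕ}
    (hn : (prefixQuotients T (List.replicate n a)).ncard ≤ n) :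
    ∃ m < n, n ≤ m + (prefixQuotients T (List.replicate n a)).ncard ∧
      T.leftQuotient (List.replicate m a) = T.leftQuotient (List.replicate n a) := by
  obtain ⟨i, j, hij, hj, h⟩ := exists_leftQuotient_take_eq (T := T) (List.replicate n a)
  rw [List.take_replicate, List.take_replicate, min_eq_left (by omega),
    min_eq_left (by omega)] at h
  refine ⟨i + (n - j), by omega, by omega, ?_⟩
  rw [List.replicate_add, T.leftQuotient_append, h, ← T.leftQuotient_append,
    List.replicate_append_replicate, Nat.add_sub_cancel' (by omega)]

end PrefixQuotients

section ShiftedInput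

variable {α : Type*} {T : Language (Option α)}

theorem prefixQuotients_shiftedInput (w : List α) :
    prefixQuotients T (shiftedInput w) = prefixQuotients T (List.replicate w.length none) ∪
      prefixQuotients (T.leftQuotient (List.replicate w.length none)) (w.map some) :=
  prefixQuotients_append _ _

theorem leftQuotient_mem_prefixQuotients_shiftedInput {v w : List α} {n : ℕ} (hn : w.length = n)
    (hv : v <+: w) :
    (T.leftQuotient (List.replicate n none)).leftQuotient (v.map some) ∈
      prefixQuotients T (shiftedInput w) := by
  rw [prefixQuotients_shiftedInput, hn]
  exact .inr ⟨_, hv.map some, rfl⟩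

theorem leftQuotient_replicate_mem_prefixQuotients_shiftedInput {w : List α} {n : ℕ}
    (hn : w.length = n) :
    T.leftQuotient (List.replicate n none) ∈ prefixQuotients T (shiftedInput w) :=
  leftQuotient_mem_prefixQuotients_shiftedInput hn w.nil_prefix

/-- Deleting loops shortens `u` below the number of quotients, and one further loop can be deleted
from the empty squares. As there are at most `w.length / 2` quotients, the shortened `u` still fits
into a word of the new length. -/
theorem exists_length_lt_leftQuotient_mem_prefixQuotients {u w : List α} (hu : u <+: w)
    (hw : 2 * (prefixQuotients T (shiftedInput w)).ncard ≤ w.length) :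
    ∃ w' : List α, w'.length < w.length ∧
      (T.leftQuotient (List.replicate w.length none)).leftQuotient (u.map some) ∈
        prefixQuotients T (shiftedInput w') := by
  set S := T.leftQuotient (List.replicate w.length none) with hS
  have hfin := finite_prefixQuotients (T := T) (shiftedInput w)
  have hsplit := prefixQuotients_shiftedInput (T := T) w
  have hcard_word : (prefixQuotients S (u.map some)).ncard ≤
      (prefixQuotients T (shiftedInput w)).ncard :=
    Set.ncard_le_ncard
      ((prefixQuotients_mono (hu.map some)).trans (hsplit ▸ Set.subset_union_right)) hfin
  have hcard_empty : (prefixQuotients T (List.replicate w.length none)).ncard ≤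
      (prefixQuotients T (shiftedInput w)).ncard :=
    Set.ncard_le_ncard (hsplit ▸ Set.subset_union_left) hfin
  obtain ⟨_, hsub, hv, hvq⟩ := exists_sublist_length_lt_leftQuotient_eq (T := S) (u.map some)
  obtain ⟨v, -, rfl⟩ := List.sublist_map_iff.1 hsub
  rw [List.length_map] at hv
  obtain ⟨m, hm, hmn, hmq⟩ :=
    exists_lt_leftQuotient_replicate_eq (T := T) (a := none) (n := w.length) (by omega)
  have hlen : ((v ++ w).take m).length = m := by
    rw [List.length_take, List.length_append]; omega
  have hprefix : v <+: (v ++ w).take m := List.prefix_take_iff.2 ⟨v.prefix_append w, by omega⟩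
  refine ⟨(v ++ w).take m, by omega, ?_⟩
  rw [← hvq, hS, ← hmq]
  exact leftQuotient_mem_prefixQuotients_shiftedInput hlen hprefix

theorem exists_length_lt_mem_prefixQuotients {w : List α}
    (hw : 2 * (prefixQuotients T (shiftedInput w)).ncard ≤ w.length) {q : Language (Option α)}
    (hq : q ∈ prefixQuotients T (shiftedInput w)) :
    ∃ w' : List α, w'.length < w.length ∧ q ∈ prefixQuotients T (shiftedInput w') := by
  rw [prefixQuotients_shiftedInput] at hq
  obtain ⟨t, ht, rfl⟩ | ⟨t, ht, rfl⟩ := hq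
  · obtain ⟨htlen, ht⟩ := List.prefix_replicate_iff.1 ht
    rw [ht]
    rcases htlen.lt_or_eq with hlt | heq
    · have hlen : (w.take t.length).length = t.length := List.length_take_of_le htlen
      exact ⟨w.take t.length, hlen.trans_lt hlt,
        leftQuotient_replicate_mem_prefixQuotients_shiftedInput hlen⟩
    · rw [heq]
      exact exists_length_lt_leftQuotient_mem_prefixQuotients w.nil_prefix hw
  · obtain ⟨u, hu, rfl⟩ := List.prefix_map_iff.1 ht
    exact exists_length_lt_leftQuotient_mem_prefixQuotients hu hw

theorem finite_iUnion_prefixQuotients_shiftedInput {S : ℕ → Set (Language (Option α))}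
    (hS : ∀ n, (S n).Finite) (hsub : ∀ w, prefixQuotients T (shiftedInput w) ⊆ S w.length)
    (hcard : ∀ᶠ n in atTop, 2 * (S n).ncard ≤ n) :
    (⋃ w, prefixQuotients T (shiftedInput w)).Finite := by
  obtain ⟨n₀, hn₀⟩ := eventually_atTop.1 hcard
  refine ((Set.finite_Iio n₀).biUnion fun n _ => hS n).subset ?_
  refine Set.iUnion_subset fun w q hq => ?_
  induction hn : w.length using Nat.strong_induction_on generalizing w with
  | _ n ih =>
    subst hn
    by_cases hw : w.length < n₀
    · exact Set.mem_biUnion (Set.mem_Iio.2 hw) (hsub w hq)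
    have hle := Set.ncard_le_ncard (hsub w) (hS _)
    have hbound := hn₀ w.length (not_lt.1 hw)
    obtain ⟨w', hlt, hq'⟩ := exists_length_lt_mem_prefixQuotients (by omega) hq
    exact ih _ hlt w' hq' rfl

/-- The graph of the map that takes the left quotient of a language by `u`, restricted to the left
quotients of `T` by `n` empty squares, where `n` is the length of some word that starts with `u`. A
graph is used so that there are only finitely many possible values for it, no matter on how many
languages the map is defined. -/
def quotientTable (T : Language (Option α)) (u : List α) :
    Set (Language (Option α) × Language (Option α)) :=
  Set.range fun v : List α =>
    (T.leftQuotient (List.replicate (u ++ v).length none),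
      (T.leftQuotient (List.replicate (u ++ v).length none)).leftQuotient (u.map some))

theorem quotientTable_subset (u : List α) :
    quotientTable T u ⊆ (⋃ w, prefixQuotients T (shiftedInput w)) ×ˢ
      ⋃ w, prefixQuotients T (shiftedInput w) := by
  rintro _ ⟨v, rfl⟩
  exact ⟨Set.mem_iUnion_of_mem (u ++ v)
      (leftQuotient_replicate_mem_prefixQuotients_shiftedInput rfl),
    Set.mem_iUnion_of_mem (u ++ v)
      (leftQuotient_mem_prefixQuotients_shiftedInput rfl (u.prefix_append v))⟩

theorem mem_leftQuotient_iff_quotientTable {L : Language α} (hL : ∀ w, w ∈ L ↔ shiftedInput w ∈ T)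
    (u v : List α) :
    v ∈ L.leftQuotient u ↔ ∃ p ∈ quotientTable T u,
      p.1 = (T.leftQuotient (List.replicate u.length none)).leftQuotient
        (List.replicate v.length none) ∧ v.map some ∈ p.2 := by
  have hmem : v ∈ L.leftQuotient u ↔ v.map some ∈
      (T.leftQuotient (List.replicate (u ++ v).length none)).leftQuotient (u.map some) := by
    rw [Language.mem_leftQuotient, hL, shiftedInput, List.map_append]
    rfl
  rw [← T.leftQuotient_append, List.replicate_append_replicate, ← List.length_append, hmem]
  constructor
  · exact fun hv => ⟨_, ⟨v, rfl⟩, rfl, hv⟩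
  · rintro ⟨_, ⟨v', rfl⟩, h, hv⟩
    exact h ▸ hv

theorem isRegular_of_finite_iUnion_prefixQuotients {L : Language α}
    (hL : ∀ w, w ∈ L ↔ shiftedInput w ∈ T)
    (hT : (⋃ w, prefixQuotients T (shiftedInput w)).Finite) : L.IsRegular := by
  set R := ⋃ w, prefixQuotients T (shiftedInput w)
  let decode (p : Language (Option α) × Set (Language (Option α) × Language (Option α))) :
      Language α :=
    {v | ∃ r ∈ p.2, r.1 = p.1.leftQuotient (List.replicate v.length none) ∧ v.map some ∈ r.2}
  refine Language.IsRegular.of_finite_range_leftQuotient <|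
    ((hT.prod (hT.prod hT).finite_subsets).image decode).subset ?_
  rintro _ ⟨u, rfl⟩
  refine ⟨(T.leftQuotient (List.replicate u.length none), quotientTable T u),
    ⟨Set.mem_iUnion_of_mem u (leftQuotient_replicate_mem_prefixQuotients_shiftedInput rfl),
      quotientTable_subset u⟩, ?_⟩
  ext v
  exact (mem_leftQuotient_iff_quotientTable hL u v).symm

theorem reduceOption_shiftedInput (w : List α) : (shiftedInput w).reduceOption = w := by
  rw [shiftedInput, List.reduceOption_append, List.reduceOption_replicate_none, List.nil_append]
  simp [List.reduceOption]

end ShiftedInput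

namespace OnlineTM

open StateTransition

variable {α : Type*} {M : OnlineTM α}

/-- The machine, started in the configuration `c`, halts in an accepting state. -/
def AcceptsFrom (c : M.Config) : Prop :=
  ∃ d ∈ eval M.next c, d.state ∈ M.accepting

theorem accepts_iff_acceptsFrom_init {t : List (Option α)} :
    M.Accepts t ↔ AcceptsFrom (M.init t) := by
  simp only [Accepts, AcceptsFrom, mem_eval, and_assoc]

theorem acceptsFrom_iff_of_reaches {c d : M.Config} (h : Reaches M.next c d) :
    AcceptsFrom c ↔ AcceptsFrom d := by
  rw [AcceptsFrom, AcceptsFrom, reaches_eval h]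

theorem acceptsFrom_iff_of_next_eq_none {c : M.Config} (h : M.next c = none) :
    AcceptsFrom c ↔ c.state ∈ M.accepting := by
  have hc : eval M.next c = Part.some c := Part.eq_some_iff.2 (mem_eval.2 ⟨.refl, h⟩)
  simp only [AcceptsFrom, hc, Part.mem_some_iff, exists_eq_left]

/-- The language of the contents of the input tape on which `M` accepts. -/
def tapeLanguage (M : OnlineTM α) : Language (Option α) := {t | M.Accepts t}

/-- The configuration `c` with `v` attached to the unread part of the input tape. -/
def Config.append (c : M.Config) (v : List (Option α)) : M.Config :=
  { c with rest := c.rest ++ v }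

/-- The contents of the unread part of the input tape on which the machine accepts when it
proceeds from `c`, which is meant to have an empty unread part itself. -/
def Config.residualLanguage (c : M.Config) : Language (Option α) :=
  {v | AcceptsFrom (c.append v)}

theorem next_append {c : M.Config} (hc : c.rest ≠ []) (v : List (Option α)) :
    M.next (c.append v) = (M.next c).map (·.append v) := by
  obtain ⟨q, work, head, _ | ⟨x, t⟩⟩ := c
  · exact absurd rfl hc
  have hscan : scanned (x :: (t ++ v)) = scanned (x :: t) := by cases x <;> rfl
  simp only [next, Config.append, List.cons_append, hscan, Option.map_map]
  congr 1
  funext ⟨q', g, m, b⟩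
  cases b <;> rfl

theorem exists_reaches_append_of_rest_eq_nil {c d : M.Config} (h : Reaches M.next c d)
    (hd : d.rest = []) :
    ∃ e : M.Config, e.rest = [] ∧ ∀ v, Reaches M.next (c.append v) (e.append v) := by
  induction h using Relation.ReflTransGen.head_induction_on with
  | refl => exact ⟨d, hd, fun _ => .refl⟩
  | @head c c' hstep _ ih =>
    by_cases hc : c.rest = []
    · exact ⟨c, hc, fun _ => .refl⟩
    obtain ⟨e, he, hreach⟩ := ih
    refine ⟨e, he, fun v => .head ?_ (hreach v)⟩
    rw [next_append hc]
    exact Option.mem_map_of_mem _ hstep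

theorem acceptsFrom_append_iff {c : M.Config} (hc : ∀ d, Reaches M.next c d → d.rest ≠ [])
    (v : List (Option α)) : AcceptsFrom (c.append v) ↔ AcceptsFrom c := by
  let sim (a b : M.Config) : Prop := Reaches M.next c a ∧ b = a.append v
  have hsim : Respects M.next M.next sim := by
    rintro a _ ⟨ha, rfl⟩
    have hnext := next_append (hc a ha) v
    cases h : M.next a with
    | none => rw [hnext, h]; rfl
    | some a' => exact ⟨a'.append v, ⟨ha.tail h, rfl⟩, .single (by rw [hnext, h]; rfl)⟩
  have hinit : sim c (c.append v) := ⟨.refl, rfl⟩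
  constructor
  · rintro ⟨b, hb, hacc⟩
    obtain ⟨a, ⟨-, rfl⟩, ha⟩ := tr_eval_rev hsim hinit hb
    exact ⟨a, ha, hacc⟩
  · rintro ⟨a, ha, hacc⟩
    obtain ⟨b, ⟨-, rfl⟩, hb⟩ := tr_eval hsim hinit ha
    exact ⟨_, hb, hacc⟩

theorem leftQuotient_tapeLanguage (M : OnlineTM α) (t : List (Option α)) :
    (∃ d : M.Config, d.rest = [] ∧ (∀ v, Reaches M.next (M.init (t ++ v)) (d.append v)) ∧
      M.tapeLanguage.leftQuotient t = d.residualLanguage) ∨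
      M.tapeLanguage.leftQuotient t ∈ ({⊤, ⊥} : Set (Language (Option α))) := by
  by_cases h : ∃ d, Reaches M.next (M.init t) d ∧ d.rest = []
  · obtain ⟨d, hd, hrest⟩ := h
    obtain ⟨e, he, hreach⟩ := exists_reaches_append_of_rest_eq_nil hd hrest
    refine .inl ⟨e, he, hreach, ?_⟩
    ext v
    exact accepts_iff_acceptsFrom_init.trans (acceptsFrom_iff_of_reaches (hreach v))
  · push Not at h
    have hconst : ∀ v, v ∈ M.tapeLanguage.leftQuotient t ↔ AcceptsFrom (M.init t) := fun v =>
      accepts_iff_acceptsFrom_init.trans (acceptsFrom_append_iff h v)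
    by_cases hacc : AcceptsFrom (M.init t)
    · exact .inr (.inl (Set.eq_univ_of_forall fun v => (hconst v).2 hacc))
    · exact .inr (.inr (Set.eq_empty_of_forall_notMem fun v => mt (hconst v).1 hacc))

theorem abs_head_sub_head_le_one {c d : M.Config} (h : d ∈ M.next c) : |d.head - c.head| ≤ 1 := by
  obtain ⟨⟨q, g, m, b⟩, -, rfl⟩ := Option.map_eq_some_iff.1 h
  cases m <;> simp

theorem exists_reaches_head_eq_of_mem_uIcc {c d : M.Config} (h : Reaches M.next c d) {z : ℤ}
    (hz : z ∈ Set.uIcc c.head d.head) : ∃ e, Reaches M.next c e ∧ e.head = z := by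
  induction h with
  | refl =>
    rw [Set.uIcc_self] at hz
    exact ⟨c, .refl, hz.symm⟩
  | @tail d e hcd hde ih =>
    by_cases hz' : z ∈ Set.uIcc c.head d.head
    · exact ih hz'
    · refine ⟨e, hcd.tail hde, ?_⟩
      have hstep := abs_le.1 (abs_head_sub_head_le_one hde)
      simp only [Set.mem_uIcc] at hz hz'
      omega

theorem work_eq_blank_of_notMem_visited {t : List (Option α)} {c : M.Config}
    (h : Reaches M.next (M.init t) c) {z : ℤ} (hz : z ∉ M.visited t) : c.work z = M.blank := by
  induction h with
  | refl => rfl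
  | @tail d e hd hde ih =>
    obtain ⟨r, -, rfl⟩ := Option.map_eq_some_iff.1 hde
    have hne : z ≠ d.head := fun h => hz ⟨d, hd, h.symm⟩
    exact (Function.update_of_ne hne _ _).trans ih

theorem visited_subset_Icc_of_usesAtMost {t : List (Option α)} {r : ℝ} (h : M.UsesAtMost t r) :
    M.visited t ⊆ Finset.Icc (-⌊r⌋₊ : ℤ) ⌊r⌋₊ := by
  rintro _ ⟨c, hc, rfl⟩
  have hsub : (Finset.uIcc 0 c.head : Set ℤ) ⊆ M.visited t := by
    rw [Finset.coe_uIcc]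
    exact fun z hz => exists_reaches_head_eq_of_mem_uIcc hc hz
  have hle := (Set.ncard_le_ncard hsub h.1).trans (Nat.le_floor h.2)
  rw [Set.ncard_coe_finset, Int.card_uIcc] at hle
  rw [Finset.coe_Icc, Set.mem_Icc]
  omega

/-- The configurations at the end of the input tape whose working head is in `I` and whose working
tape is blank outside `I`. -/
def endConfigs (M : OnlineTM α) (I : Finset ℤ) : Set M.Config :=
  {c | c.rest = [] ∧ c.head ∈ I ∧ ∀ z ∉ I, c.work z = M.blank}

theorem exists_injective_endConfigs (M : OnlineTM α) (I : Finset ℤ) :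
    ∃ f : M.endConfigs I → M.State × I × (I → M.WorkSymbol), Function.Injective f := by
  refine ⟨fun c => (c.1.state, ⟨c.1.head, c.2.2.1⟩, fun z => c.1.work z), ?_⟩
  rintro ⟨⟨q, work, head, rest⟩, hrest, _, hblank⟩ ⟨⟨q', work', head', rest'⟩, hrest', _, hblank'⟩ h
  simp only [Prod.mk.injEq, Subtype.mk.injEq] at h
  obtain ⟨rfl, rfl, hwork⟩ := h
  obtain rfl : rest = [] := hrest
  obtain rfl : rest' = [] := hrest'
  obtain rfl : work = work' := by
    funext z
    by_cases hz : z ∈ I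
    · exact congrFun hwork ⟨z, hz⟩
    · exact (hblank z hz).trans (hblank' z hz).symm
  rfl

theorem finite_endConfigs (M : OnlineTM α) (I : Finset ℤ) : (M.endConfigs I).Finite := by
  have := M.finiteState
  have := M.finiteWorkSymbol
  obtain ⟨f, hf⟩ := M.exists_injective_endConfigs I
  exact Finite.of_injective f hf

theorem ncard_endConfigs_le (M : OnlineTM α) (I : Finset ℤ) :
    (M.endConfigs I).ncard ≤
      Nat.card M.State * (I.card * Nat.card M.WorkSymbol ^ I.card) := by
  have := M.finiteState
  have := M.finiteWorkSymbol
  obtain ⟨f, hf⟩ := M.exists_injective_endConfigs I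
  simpa [Nat.card_prod, Nat.card_fun] using Nat.card_le_card_of_injective f hf

/-- The residual languages of the configurations in `M.endConfigs I`, and the two languages that
arise as left quotients by words which the machine does not read completely. -/
def residualLanguages (M : OnlineTM α) (I : Finset ℤ) : Set (Language (Option α)) :=
  Config.residualLanguage '' M.endConfigs I ∪ {⊤, ⊥}

theorem finite_residualLanguages (M : OnlineTM α) (I : Finset ℤ) :
    (M.residualLanguages I).Finite :=
  ((M.finite_endConfigs I).image _).union (Set.toFinite _)

theorem ncard_residualLanguages_le (M : OnlineTM α) (I : Finset ℤ) :
    (M.residualLanguages I).ncard ≤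
      Nat.card M.State * (I.card * Nat.card M.WorkSymbol ^ I.card) + 2 :=
  (Set.ncard_union_le _ _).trans <| add_le_add
    ((Set.ncard_image_le (M.finite_endConfigs I)).trans (M.ncard_endConfigs_le I))
    ((Set.ncard_insert_le _ _).trans_eq (by rw [Set.ncard_singleton]))

theorem card_workSymbol_pos (M : OnlineTM α) : 0 < Nat.card M.WorkSymbol :=
  have := M.finiteWorkSymbol
  have : Nonempty M.WorkSymbol := ⟨M.blank⟩
  Nat.card_pos

theorem ncard_residualLanguages_Icc_le (M : OnlineTM α) (s : ℕ) :
    (M.residualLanguages (Finset.Icc (-s : ℤ) s)).ncard ≤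
      (Nat.card M.State * (2 * Nat.card M.WorkSymbol) + 2) *
        ((2 * Nat.card M.WorkSymbol) ^ 2) ^ s := by
  have hcard : (Finset.Icc (-s : ℤ) s).card = 2 * s + 1 := by rw [Int.card_Icc]; omega
  refine (M.ncard_residualLanguages_le _).trans ?_
  rw [hcard]
  set Q := Nat.card M.State
  set G := Nat.card M.WorkSymbol
  have hG : 0 < G := M.card_workSymbol_pos
  have hone : 1 ≤ ((2 * G) ^ 2) ^ s := Nat.one_le_pow _ _ (by positivity)
  calc Q * ((2 * s + 1) * G ^ (2 * s + 1)) + 2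
      ≤ Q * (2 ^ (2 * s + 1) * G ^ (2 * s + 1)) + 2 := by
        gcongr; exact Nat.lt_two_pow_self.le
    _ = Q * (2 * G) * ((2 * G) ^ 2) ^ s + 2 := by rw [← mul_pow, pow_succ, pow_mul]; ring
    _ ≤ (Q * (2 * G) + 2) * ((2 * G) ^ 2) ^ s := by rw [add_mul]; omega

theorem prefixQuotients_tapeLanguage_subset {t : List (Option α)} {I : Finset ℤ}
    (hI : M.visited t ⊆ I) : prefixQuotients M.tapeLanguage t ⊆ M.residualLanguages I := by
  rintro _ ⟨u, ⟨v, rfl⟩, rfl⟩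
  rcases M.leftQuotient_tapeLanguage u with ⟨d, hrest, hd, h⟩ | h
  · rw [h]
    exact .inl ⟨d, ⟨hrest, hI ⟨_, hd v, rfl⟩,
      fun z hz => work_eq_blank_of_notMem_visited (hd v) fun hz' => hz (hI hz')⟩, rfl⟩
  · exact .inr h

end OnlineTM

theorem isRegular_of_mem_oneDSpaceShiftedLittleO_log {α : Type*} {L : Language α}
    (hL : L ∈ OneDSpaceShiftedLittleO α fun n => Real.log n) : L.IsRegular := by
  obtain ⟨f, hf, M, hM⟩ := hL
  let S (n : ℕ) := M.residualLanguages (Finset.Icc (-⌊f n⌋₊ : ℤ) ⌊f n⌋₊)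
  have hsub (w : List α) : prefixQuotients M.tapeLanguage (shiftedInput w) ⊆ S w.length :=
    OnlineTM.prefixQuotients_tapeLanguage_subset
      (OnlineTM.visited_subset_Icc_of_usesAtMost (hM w).2)
  have hcard : ∀ᶠ n in atTop, 2 * (S n).ncard ≤ n := by
    have hpos : 0 < (2 * Nat.card M.WorkSymbol) ^ 2 := by
      have := M.card_workSymbol_pos
      positivity
    filter_upwards [eventually_mul_pow_natFloor_le hf
      (2 * (Nat.card M.State * (2 * Nat.card M.WorkSymbol) + 2)) hpos] with n hn
    rw [mul_assoc] at hn
    exact (Nat.mul_le_mul_left 2 (M.ncard_residualLanguages_Icc_le _)).trans hn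
  exact isRegular_of_finite_iUnion_prefixQuotients (T := M.tapeLanguage) (fun w => (hM w).1)
    (finite_iUnion_prefixQuotients_shiftedInput (fun _ => M.finite_residualLanguages _) hsub hcard)

namespace OnlineTM

open StateTransition

variable {α : Type*} {σ : Type} [Finite σ] (D : DFA α σ)

/-- The machine that runs the automaton `D` on the letters of the input, skips the empty squares,
and never uses its working tape. -/
def ofDFA : OnlineTM α where
  State := σ
  WorkSymbol := Unit
  blank := ()
  start := D.start
  accepting := D.accept
  step q x _ := match x with
    | .empty => some (q, (), 0, true)
    | .letter a => some (D.step q a, (), 0, true)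
    | .endMark => none

theorem reaches_ofDFA (t : List (Option α)) (q : σ) :
    Reaches (ofDFA D).next (⟨q, fun _ => (), 0, t⟩ : (ofDFA D).Config)
      ⟨D.evalFrom q t.reduceOption, fun _ => (), 0, []⟩ := by
  induction t generalizing q with
  | nil => exact .refl
  | cons x t ih =>
    cases x with
    | none => exact .head rfl (ih q)
    | some a => exact .head rfl (ih (D.step q a))

theorem accepts_ofDFA_iff (t : List (Option α)) :
    (ofDFA D).Accepts t ↔ t.reduceOption ∈ D.accepts := by
  rw [accepts_iff_acceptsFrom_init]
  exact (acceptsFrom_iff_of_reaches (reaches_ofDFA D t D.start)).trans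
    (acceptsFrom_iff_of_next_eq_none rfl)

theorem visited_ofDFA (t : List (Option α)) : (ofDFA D).visited t = {0} := by
  refine Set.Subset.antisymm ?_ (Set.singleton_subset_iff.2 ⟨_, .refl, rfl⟩)
  rintro _ ⟨c, hc, rfl⟩
  rw [Set.mem_singleton_iff]
  induction hc with
  | refl => rfl
  | @tail d e _ hde ih =>
    obtain ⟨⟨q, g, m, b⟩, hstep, rfl⟩ := Option.map_eq_some_iff.1 hde
    have hm : m = 0 := by
      simp only [ofDFA] at hstep
      split at hstep <;> cases hstep <;> rfl
    simp [ih, hm]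

end OnlineTM

theorem mem_oneDSpaceShifted_one_of_isRegular {α : Type*} {L : Language α} (hL : L.IsRegular) :
    L ∈ OneDSpaceShifted α fun _ => 1 := by
  obtain ⟨σ, _, D, rfl⟩ := hL
  refine ⟨OnlineTM.ofDFA D, fun w => ⟨?_, ?_⟩⟩
  · rw [OnlineTM.accepts_ofDFA_iff, reduceOption_shiftedInput]
  · simp [OnlineTM.UsesAtMost, OnlineTM.visited_ofDFA]

theorem mainTheorem7_general {α : Type*} :
    OneDSpaceShiftedLittleO α (fun n => Real.log n) = {L : Language α | L.IsRegular} :=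
  Set.Subset.antisymm (fun _ hL => isRegular_of_mem_oneDSpaceShiftedLittleO_log hL) fun _ hL =>
    ⟨_, Real.isLittleO_const_log_atTop.comp_tendsto tendsto_natCast_atTop_atTop,
      mem_oneDSpaceShifted_one_of_isRegular hL⟩

theorem mainTheorem7 {α : Type*} [Finite α] :
    OneDSpaceShiftedLittleO α (fun n => Real.log n) = {L : Language α | L.IsRegular} :=
  mainTheorem7_general
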